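/- Let $\mathbb A$ be a finite-dimensional real algebra with unit $1$, not necessarily associative, which is alternative (the associator $(ab)c-a(bc)$ is alternating) and is equipped with an $\mathbb R$-linear anti-involution $a\mapsto a^c$. Write $t(x)=x+x^c$, $n(x)=xx^c$ and $\mathbb S_{\mathbb A}=\{x\in\mathbb A: t(x)=0,\ n(x)=1\}$. Let $M$ be a hypercomplex subspace of $\mathbb A$, i.e. a real vector subspace with $\mathbb R\subsetneq M\subseteq Q_{\mathbb A}:=\mathbb R\cup\{x\in\mathbb A: t(x),n(x)\in\mathbb R,\ 4n(x)>t(x)^2\}$, and let $\mathcal B=(v_0,v_1,\dots,v_m)$ be a hypercomplex basis of $M$, i.e. a real basis with $m\ge 1$, $v_0=1$, $v_s\in\mathbb S_{\mathbb A}$ and $v_sv_t=-v_tv_s$ for all distinct $s,t\in\{1,\dots,m\}$. Complete $\mathcal B$ to a real basis $(v_0,\dots,v_d)$ of $\mathbb A$; smoothness and partial derivatives of $\mathbb A$-valued functions are understood componentwise in this basis. Identify $(x_0,\dots,x_m)\in\mathbb R^{m+1}$ with $x=\sum_{s=0}^m x_sv_s\in M$, and $\underline x=(x_1,\dots,x_m)\in\mathbb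 R^m$ with $\sum_{s=1}^m x_sv_s\in M$. A $C^1$ function $F:M\to\mathbb A$ is called left monogenic if $\sum_{s=0}^m v_s\,\partial_sF=0$ on $M$, and right monogenic if $\sum_{s=0}^m(\partial_sF)\,v_s=0$ on $M$. Let $f_0:\mathbb R^m\to\mathbb A$ be a polynomial. For $f:\mathbb R^m\to\mathbb A$ put $\underline{\overline\partial}_{\mathcal B}f=\sum_{s=1}^m v_s\,\partial_sf$ and $f\,\underline{\overline\partial}_{\mathcal B}=\sum_{s=1}^m(\partial_sf)\,v_s$, and define, for $x=x_0+\underline x\in M$, $$CK^L[f_0](x)=\sum_{k=0}^{\infty}\frac{(-x_0)^k}{k!}\big((\underline{\overline\partial}_{\mathcal B})^kf_0\big)(\underline x),\qquad CK^R[f_0](x)=\sum_{k=0}^{\infty}\frac{(-x_0)^k}{k!}\big(f_0(\underline{\overline\partial}_{\mathcal B})^k\big)(\underline x),$$ where the powers denote iterated application of the operators. Then both series are finite sums: $(\underline{\overline\partial}_{\mathcal B})^kf_0=0=f_0(\underline{\overline\partial}_{\mathcal B})^k$ for all sufficiently large $k$. The function $CK^L[f_0]$ is left monogenic on $M$, extends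 $f_0$ (that is, $CK^L[f_0](\underline x)=f_0(\underline x)$ for all $\underline x\in\mathbb R^m$), and is the only left monogenic function $F:M\to\mathbb A$ that extends $f_0$. Likewise, $CK^R[f_0]$ is right monogenic on $M$, extends $f_0$, and is the only right monogenic function $F:M\to\mathbb A$ that extends $f_0$. If moreover $f_0$ is $\mathbb R$-valued, then $CK^L[f_0]=CK^R[f_0]$, and this function takes its values in $M$. -/

import Mathlib

namespace Hypercomplex

/-- A (not necessarily associative) ring is alternative if its associator
`[x, y, z] = (x y) z - x (y z)` is an alternating function of its three arguments. -/
def IsAlternative (A : Type*) [NonAssocRing A] : Prop :=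
  ∀ x y : A, associator x x y = 0 ∧ associator x y y = 0 ∧ associator x y x = 0

/-- The imaginary units: elements with trace `x + xᶜ = 0` and squared norm `x xᶜ = 1`. -/
def imaginaryUnits (A : Type*) [NonAssocRing A] [StarRing A] : Set A :=
  {x | x + star x = 0 ∧ x * star x = 1}

/-- The quadratic cone: the reals `ℝ · 1` together with the elements whose trace `t` and squared
norm `n` are real and satisfy `t ^ 2 < 4 n`. -/
def quadraticCone (A : Type*) [NonAssocRing A] [StarRing A] [Module ℝ A] : Set A :=
  {x | ∃ r : ℝ, x = r • (1 : A)} ∪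
    {x | ∃ t n : ℝ, x + star x = t • (1 : A) ∧ x * star x = n • (1 : A) ∧ t ^ 2 < 4 * n}

/-- `ℝ ⊊ M ⊆ Q_A`. -/
def IsHypercomplexSubspace {A : Type*} [NonAssocRing A] [StarRing A] [Module ℝ A]
    (M : Submodule ℝ A) : Prop :=
  Submodule.span ℝ {(1 : A)} < M ∧ (M : Set A) ⊆ quadraticCone A

/-- A basis `(v₀, …, v_m)` of `M` is hypercomplex if `m ≥ 1`, `v₀ = 1`, and `v₁, …, v_m` are
pairwise anticommuting imaginary units. -/
def IsHypercomplexBasis {A : Type*} [NonAssocRing A] [StarRing A] [Module ℝ A]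
    {M : Submodule ℝ A} {m : ℕ} (v : Module.Basis (Fin (m + 1)) ℝ M) : Prop :=
  1 ≤ m ∧ (v 0 : A) = 1 ∧
    (∀ s : Fin m, (v s.succ : A) ∈ imaginaryUnits A) ∧
    ∀ s t : Fin m, s ≠ t → (v s.succ : A) * (v t.succ : A) = -((v t.succ : A) * (v s.succ : A))

section Calculus

variable {A : Type*} [NonAssocRing A] [Module ℝ A] {d n : ℕ}

/-- The real components `f_t` of `f = ∑ₜ v_t f_t` with respect to a basis `(v₀, …, v_d)` of `A`. -/
noncomputable def component (b : Module.Basis (Fin (d + 1)) ℝ A) (f : (Fin n → ℝ) → A)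
    (t : Fin (d + 1)) : (Fin n → ℝ) → ℝ :=
  fun x => b.repr (f x) t

/-- `f` is of class `C¹`: all its real components are. -/
def IsC1 (b : Module.Basis (Fin (d + 1)) ℝ A) (f : (Fin n → ℝ) → A) : Prop :=
  ∀ t, ContDiff ℝ 1 (component b f t)

/-- `f` is a polynomial with coefficients in `A`: all its real components are polynomials. -/
def IsPolynomialMap (b : Module.Basis (Fin (d + 1)) ℝ A) (f : (Fin n → ℝ) → A) : Prop :=
  ∀ t, ∃ p : MvPolynomial (Fin n) ℝ, ∀ x, component b f t x = MvPolynomial.eval x p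

/-- The partial derivative `∂f/∂x_s = ∑ₜ v_t ∂f_t/∂x_s`. -/
noncomputable def partialDeriv (b : Module.Basis (Fin (d + 1)) ℝ A) (s : Fin n)
    (f : (Fin n → ℝ) → A) : (Fin n → ℝ) → A :=
  fun x => ∑ t, lineDeriv ℝ (component b f t) x (Pi.single s 1) • b t

/-- The operator `f ↦ ∑ₛ e_s ∂f/∂x_s`, for a family `e` of elements of `A`. -/
noncomputable def leftDirac (b : Module.Basis (Fin (d + 1)) ℝ A) (e : Fin n → A)
    (f : (Fin n → ℝ) → A) : (Fin n → ℝ) → A :=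
  fun x => ∑ s, e s * partialDeriv b s f x

/-- The operator `f ↦ ∑ₛ (∂f/∂x_s) e_s`, for a family `e` of elements of `A`. -/
noncomputable def rightDirac (b : Module.Basis (Fin (d + 1)) ℝ A) (e : Fin n → A)
    (f : (Fin n → ℝ) → A) : (Fin n → ℝ) → A :=
  fun x => ∑ s, partialDeriv b s f x * e s

end Calculus

section Monogenic

variable {A : Type*} [NonAssocRing A] [Module ℝ A] {M : Submodule ℝ A} {d m : ℕ}

/-- A function on `M`, read as a function on `ℝ^(m+1)` through the identification
`(x₀, …, x_m) ↦ ∑ₛ x_s v_s`. -/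
noncomputable def inCoords (v : Module.Basis (Fin (m + 1)) ℝ M) (F : M → A) :
    (Fin (m + 1) → ℝ) → A :=
  fun x => F (∑ s, x s • v s)

/-- `F : M → A` is left monogenic on `M`: it is of class `C¹` and `∑ₛ v_s ∂F/∂x_s = 0`. -/
def IsLeftMonogenic (b : Module.Basis (Fin (d + 1)) ℝ A) (v : Module.Basis (Fin (m + 1)) ℝ M)
    (F : M → A) : Prop :=
  IsC1 b (inCoords v F) ∧ ∀ x, leftDirac b (fun s => (v s : A)) (inCoords v F) x = 0

/-- `F : M → A` is right monogenic on `M`: it is of class `C¹` and `∑ₛ (∂F/∂x_s) v_s = 0`. -/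
def IsRightMonogenic (b : Module.Basis (Fin (d + 1)) ℝ A) (v : Module.Basis (Fin (m + 1)) ℝ M)
    (F : M → A) : Prop :=
  IsC1 b (inCoords v F) ∧ ∀ x, rightDirac b (fun s => (v s : A)) (inCoords v F) x = 0

/-- `F : M → A` extends `f₀ : ℝ^m → A`, where `(x₁, …, x_m) ∈ ℝ^m` is identified with the point
`x₁ v₁ + ⋯ + x_m v_m` of `M`. -/
def Extends (v : Module.Basis (Fin (m + 1)) ℝ M) (F : M → A) (f₀ : (Fin m → ℝ) → A) : Prop :=
  ∀ y : Fin m → ℝ, F (∑ s : Fin m, y s • v s.succ) = f₀ y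

/-- The operator `f ↦ ∑_{s=1}^m v_s ∂f/∂x_s` on functions `ℝ^m → A`. -/
noncomputable def leftDiracB (b : Module.Basis (Fin (d + 1)) ℝ A)
    (v : Module.Basis (Fin (m + 1)) ℝ M) (f : (Fin m → ℝ) → A) : (Fin m → ℝ) → A :=
  leftDirac b (fun s : Fin m => (v s.succ : A)) f

/-- The operator `f ↦ ∑_{s=1}^m (∂f/∂x_s) v_s` on functions `ℝ^m → A`. -/
noncomputable def rightDiracB (b : Module.Basis (Fin (d + 1)) ℝ A)
    (v : Module.Basis (Fin (m + 1)) ℝ M) (f : (Fin m → ℝ) → A) : (Fin m → ℝ) → A :=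
  rightDirac b (fun s : Fin m => (v s.succ : A)) f

/-- The left Cauchy-Kovalevskaya extension of `f₀`: the value at `x = x₀ + ∑_{s≥1} x_s v_s` is
`∑ₖ (-x₀)^k / k! • (D^k f₀)(x₁, …, x_m)`, `D` the left operator `∑_{s≥1} v_s ∂_s`.  For a
polynomial `f₀` only finitely many terms are nonzero. -/
noncomputable def leftCK (b : Module.Basis (Fin (d + 1)) ℝ A)
    (v : Module.Basis (Fin (m + 1)) ℝ M) (f₀ : (Fin m → ℝ) → A) : M → A :=
  fun x => ∑ᶠ k : ℕ, ((-(v.repr x 0)) ^ k / (k.factorial : ℝ)) •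
    ((leftDiracB b v)^[k] f₀) (fun s : Fin m => v.repr x s.succ)

/-- The right Cauchy-Kovalevskaya extension of `f₀`. -/
noncomputable def rightCK (b : Module.Basis (Fin (d + 1)) ℝ A)
    (v : Module.Basis (Fin (m + 1)) ℝ M) (f₀ : (Fin m → ℝ) → A) : M → A :=
  fun x => ∑ᶠ k : ℕ, ((-(v.repr x 0)) ^ k / (k.factorial : ℝ)) •
    ((rightDiracB b v)^[k] f₀) (fun s : Fin m => v.repr x s.succ)

end Monogenic

end Hypercomplex

open Hypercomplex

/-! Alternativity replaces associativity at one point: polarising x(xa) = (xx)a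
(`IsAlternative.mul_mul_add`) shows that left multiplications by v_1, …, v_m anticommute and square
to -1. The same holds on the right, so both cases are instances of a system ∑ T_s ∂_s with T_0 = id
(`ckExtension_spec`).

Existence: each application of the operator lowers polynomial degree, so the series is finite, and
differentiating it term by term telescopes.

Uniqueness among C¹ functions is the analytic part. Composing with the conjugate operator gives the
Laplacian, so a C¹ solution is weakly harmonic and satisfies a mean value property with a smooth
radial weight. This makes it smooth (`contDiff_of_sum_fderiv_eq_zero`) and yields interior
derivative estimates. If it vanishes on x_0 = 0, the equation makes all its normal derivatives
vanish there. Estimates on k nested balls of radius r/k bound the k-th Taylor remainder by a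
multiple of (Ke/r)^k, which tends to 0 for r large (`eq_zero_of_sum_fderiv_eq_zero`).

For real f₀, both operators square to minus the Laplacian, which preserves real-valuedness. Even
iterates are therefore real, and odd ones are real combinations of the v_s, the same on either side
(`iterate_dirac_eq_and_mem`). -/

namespace Hypercomplex

open MeasureTheory Set Filter Topology
open scoped ContDiff

/-! ### Weak harmonicity, the mean value property and smoothness of C¹ solutions -/

section MeanValue

variable {n : ℕ} {V : Type*} [NormedAddCommGroup V] [NormedSpace ℝ V]

/-- A compactly supported antiderivative on the half line `s ≥ 0` of a smooth cutoff. -/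
lemma exists_contDiff_antideriv_cutoff :
    ∃ w W : ℝ → ℝ, ContDiff ℝ ∞ w ∧ ContDiff ℝ ∞ W ∧ (∀ s, HasDerivAt W (w s) s) ∧
      (∀ s, 0 ≤ w s) ∧ w 0 ≠ 0 ∧ (∀ s, 2 ≤ s → w s = 0) ∧ ∀ s, 2 ≤ s → W s = 0 := by
  let β : ContDiffBump (0 : ℝ) := ⟨1, 2, by norm_num, by norm_num⟩
  have hβ : ContDiff ℝ ∞ β := β.contDiff
  have hz : ∀ s : ℝ, 2 ≤ s → β s = 0 := fun s hs =>
    β.zero_of_le_dist (by simpa [β] using hs.trans (le_abs_self s))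
  -- The primitive starts at 2, where the bump has died out, so it vanishes beyond 2. Its behaviour
  -- for s < 0 is irrelevant: only s = |y|² will be used.
  have hd : ∀ s, HasDerivAt (fun s => ∫ x in (2 : ℝ)..s, β x) (β s) s := fun s =>
    intervalIntegral.integral_hasDerivAt_right (hβ.continuous.intervalIntegrable _ _)
      (hβ.continuous.stronglyMeasurableAtFilter _ _) hβ.continuous.continuousAt
  refine ⟨β, _, hβ, ?_, hd, fun s => β.nonneg, ?_, hz, fun s hs => ?_⟩
  · rw [contDiff_infty_iff_deriv]
    refine ⟨fun s => (hd s).differentiableAt, ?_⟩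
    rwa [show deriv (fun s => ∫ x in (2 : ℝ)..s, β x) = β from funext fun s => (hd s).deriv]
  · rw [β.one_of_mem_closedBall (by simp [β])]
    norm_num
  · have : EqOn β (fun _ => 0) (uIcc 2 s) := fun x hx => hz x (by rw [uIcc_of_le hs] at hx; exact hx.1)
    simp [intervalIntegral.integral_congr this]

lemma hasCompactSupport_comp_sum_sq {w : ℝ → ℝ} (hw : ∀ s, 2 ≤ s → w s = 0) :
    HasCompactSupport (fun y : Fin n → ℝ => w (∑ i, y i ^ 2)) := by
  refine HasCompactSupport.intro (isCompact_closedBall (0 : Fin n → ℝ) 2) fun y hy => hw _ ?_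
  by_contra! h
  refine hy ?_
  rw [mem_closedBall_zero_iff, pi_norm_le_iff_of_nonneg (by norm_num)]
  intro i
  have : y i ^ 2 ≤ ∑ i, y i ^ 2 :=
    Finset.single_le_sum (f := fun i => y i ^ 2) (fun i _ => sq_nonneg _) (Finset.mem_univ i)
  rw [Real.norm_eq_abs]
  exact abs_le_of_sq_le_sq (by linarith) (by norm_num)

/-- A smooth radial cutoff `φ` such that the vector field `y φ(y)` is a gradient of a compactly
supported function. -/
lemma exists_radial_cutoff (n : ℕ) :
    ∃ φ Ψ : (Fin n → ℝ) → ℝ, ContDiff ℝ ∞ φ ∧ ContDiff ℝ ∞ Ψ ∧ HasCompactSupport φ ∧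
      HasCompactSupport Ψ ∧ 0 < ∫ y, φ y ∧
      ∀ s y, fderiv ℝ Ψ y (Pi.single s 1) = φ y * y s := by
  obtain ⟨w, W, hw, hW, hd, h0, h1, hw2, hW2⟩ := exists_contDiff_antideriv_cutoff
  have hq : ContDiff ℝ ∞ (fun y : Fin n → ℝ => ∑ i, y i ^ 2) := by fun_prop
  refine ⟨fun y => w (∑ i, y i ^ 2), fun y => W (∑ i, y i ^ 2) / 2, hw.comp hq,
    (hW.comp hq).div_const 2, hasCompactSupport_comp_sum_sq hw2,
    hasCompactSupport_comp_sum_sq (w := fun s => W s / 2) (fun s hs => by simp [hW2 s hs]), ?_, ?_⟩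
  · refine Continuous.integral_pos_of_hasCompactSupport_nonneg_nonzero (x := 0)
      (hw.comp hq).continuous (hasCompactSupport_comp_sum_sq hw2) (fun y => h0 _) (by simpa using h1)
  · intro s y
    have hq' : HasFDerivAt (fun y : Fin n → ℝ => ∑ i, y i ^ 2)
        (∑ i, (2 * y i) • ContinuousLinearMap.proj (R := ℝ) (φ := fun _ : Fin n => ℝ) i) y := by
      refine HasFDerivAt.fun_sum fun i _ => ?_
      simpa using (hasFDerivAt_apply (𝕜 := ℝ) i y).pow 2
    have := ((hd (∑ i, y i ^ 2)).comp_hasFDerivAt y hq').mul_const (2⁻¹ : ℝ)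
    simp only [Function.comp_def, ← div_eq_mul_inv] at this
    rw [this.fderiv]
    simp [Pi.single_apply]
    ring

lemma integrable_smul_of_hasCompactSupport {φ : (Fin n → ℝ) → ℝ} {G : (Fin n → ℝ) → V}
    (hφ : Continuous φ) (hφs : HasCompactSupport φ) (hG : Continuous G) :
    Integrable (fun y => φ y • G y) :=
  (hφ.smul hG).integrable_of_hasCompactSupport hφs.smul_right

/-- Integration by parts against a compactly supported function. -/
lemma integral_smul_fderiv_of_hasCompactSupport {φ : (Fin n → ℝ) → ℝ} {G : (Fin n → ℝ) → V}
    (hφ : ContDiff ℝ 1 φ) (hφs : HasCompactSupport φ) (hG : ContDiff ℝ 1 G) (u : Fin n → ℝ) :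
    ∫ y, φ y • fderiv ℝ G y u = -∫ y, fderiv ℝ φ y u • G y := by
  have hφ' : Continuous fun y => fderiv ℝ φ y u :=
    (hφ.continuous_fderiv one_ne_zero).clm_apply continuous_const
  have hG' : Continuous fun y => fderiv ℝ G y u :=
    (hG.continuous_fderiv one_ne_zero).clm_apply continuous_const
  exact integral_smul_fderiv_eq_neg_fderiv_smul_of_integrable
    (integrable_smul_of_hasCompactSupport hφ' (hφs.fderiv_apply ℝ u) hG.continuous)
    (integrable_smul_of_hasCompactSupport hφ.continuous hφs hG')
    (integrable_smul_of_hasCompactSupport hφ.continuous hφs hG.continuous)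
    (fun x _ => hφ.differentiable one_ne_zero x) (fun x _ => hG.differentiable one_ne_zero x)

/-- Differentiating the weighted mean in the radius; the mean value property follows once this
derivative is shown to vanish. -/
lemma hasDerivAt_integral_smul_dilation {φ : (Fin n → ℝ) → ℝ} (hφ : Continuous φ)
    (hφs : HasCompactSupport φ) {G : (Fin n → ℝ) → V} (hG : ContDiff ℝ 1 G) (x : Fin n → ℝ)
    (r : ℝ) :
    HasDerivAt (fun r : ℝ => ∫ y, φ y • G (x + r • y)) (∫ y, φ y • fderiv ℝ G (x + r • y) y) r := by
  have hG' := hG.continuous_fderiv one_ne_zero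
  have hc : Continuous fun p : ℝ × (Fin n → ℝ) => φ p.2 • fderiv ℝ G (x + p.1 • p.2) p.2 := by
    fun_prop
  obtain ⟨K, hK⟩ := ((isCompact_closedBall r 1).prod hφs.isCompact).exists_bound_of_continuousOn
    hc.continuousOn
  refine (hasDerivAt_integral_of_dominated_loc_of_deriv_le (s := Metric.closedBall r 1)
    (F' := fun r y => φ y • fderiv ℝ G (x + r • y) y)
    (bound := (tsupport φ).indicator fun _ => K)
    (Metric.closedBall_mem_nhds r one_pos) ?_ ?_ ?_ ?_ ?_ ?_).2
  · exact .of_forall fun r => (hφ.smul (hG.continuous.comp (by fun_prop))).aestronglyMeasurable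
  · exact integrable_smul_of_hasCompactSupport hφ hφs (hG.continuous.comp (by fun_prop))
  · exact (hc.comp (Continuous.prodMk_right r)).aestronglyMeasurable
  · refine .of_forall fun y ρ hρ => ?_
    by_cases hy : y ∈ tsupport φ
    · rw [indicator_of_mem hy]
      exact hK (ρ, y) ⟨hρ, hy⟩
    · simp [indicator_of_notMem hy, image_eq_zero_of_notMem_tsupport hy]
  · exact (integrable_indicator_iff (isClosed_tsupport φ).measurableSet).2
      (integrableOn_const hφs.isCompact.measure_lt_top.ne)
  · refine .of_forall fun y ρ _ => ?_
    have h1 : HasDerivAt (fun ρ : ℝ => x + ρ • y) y ρ := by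
      simpa using ((hasDerivAt_id ρ).smul_const y).const_add x
    exact ((hG.differentiable one_ne_zero _).hasFDerivAt.comp_hasDerivAt ρ h1).const_smul (φ y)

lemma fderiv_dilation {G : (Fin n → ℝ) → V} (hG : ContDiff ℝ 1 G) (x : Fin n → ℝ) (r : ℝ)
    (y u : Fin n → ℝ) :
    fderiv ℝ (fun y => G (x + r • y)) y u = r • fderiv ℝ G (x + r • y) u := by
  have h1 : HasFDerivAt (fun y : Fin n → ℝ => x + r • y)
      (r • ContinuousLinearMap.id ℝ (Fin n → ℝ)) y :=
    ((hasFDerivAt_id y).const_smul r).const_add x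
  have h2 : HasFDerivAt G (fderiv ℝ G (x + r • y)) (x + r • y) :=
    (hG.differentiable one_ne_zero _).hasFDerivAt
  have h3 := h2.comp y h1
  simp only [Function.comp_def] at h3
  rw [h3.fderiv]
  simp

variable [CompleteSpace V] {C L : Fin n → V →L[ℝ] V}

/-- A `C¹` solution of a first-order system whose square is the Laplacian is weakly harmonic. -/
lemma sum_integral_fderiv_smul_fderiv_eq_zero
    (hCL : ∀ s t a, C t (L s a) + C s (L t a) = if s = t then (2 : ℝ) • a else 0)
    {Ψ : (Fin n → ℝ) → ℝ} (hΨ : ContDiff ℝ ∞ Ψ) (hΨs : HasCompactSupport Ψ)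
    {G : (Fin n → ℝ) → V} (hG : ContDiff ℝ 1 G)
    (hmono : ∀ x, ∑ s, L s (fderiv ℝ G x (Pi.single s 1)) = 0) :
    ∑ s, ∫ y, fderiv ℝ Ψ y (Pi.single s 1) • fderiv ℝ G y (Pi.single s 1) = 0 := by
  set e : Fin n → Fin n → ℝ := fun s => Pi.single s 1 with he
  have hΨ' : ∀ t, ContDiff ℝ ∞ fun y => fderiv ℝ Ψ y (e t) := fun t =>
    (hΨ.fderiv_right (m := ∞) (by simp)).clm_apply contDiff_const
  have hG' : ∀ s, Continuous fun y => fderiv ℝ G y (e s) := fun s =>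
    (hG.continuous_fderiv one_ne_zero).clm_apply continuous_const
  set I : Fin n → Fin n → V := fun s t => ∫ y, fderiv ℝ Ψ y (e t) • fderiv ℝ G y (e s) with hI
  have hint : ∀ s t, Integrable fun y => fderiv ℝ Ψ y (e t) • fderiv ℝ G y (e s) := fun s t =>
    integrable_smul_of_hasCompactSupport (hΨ' t).continuous (hΨs.fderiv_apply ℝ _) (hG' s)
  -- G is only C¹, so its derivative is moved onto Ψ, whose second derivative is symmetric.
  have hsymm : ∀ s t, I s t = I t s := by
    intro s t
    simp only [hI]
    rw [integral_smul_fderiv_of_hasCompactSupport ((hΨ' t).of_le (by simp))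
        (hΨs.fderiv_apply ℝ _) hG,
      integral_smul_fderiv_of_hasCompactSupport ((hΨ' s).of_le (by simp))
        (hΨs.fderiv_apply ℝ _) hG]
    congr 2
    ext y
    congr 1
    have hd : DifferentiableAt ℝ (fderiv ℝ Ψ) y :=
      (hΨ.fderiv_right (m := ∞) (by simp)).differentiable (by simp) y
    rw [fderiv_clm_apply hd (by fun_prop), fderiv_clm_apply hd (by fun_prop)]
    simpa using ((hΨ.of_le (m := 2) ENat.LEInfty.out).contDiffAt.isSymmSndFDerivAt (by simp)) (e s) (e t)
  have hzero : ∑ t, ∑ s, C t (L s (I s t)) = 0 := by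
    refine Finset.sum_eq_zero fun t _ => ?_
    rw [← map_sum]
    suffices ∑ s, L s (I s t) = 0 by rw [this, map_zero]
    simp only [hI, ← ContinuousLinearMap.integral_comp_comm _ (hint _ t)]
    rw [← integral_finsetSum _ fun s _ => (L s).integrable_comp (hint s t)]
    simp [← Finset.smul_sum, he, hmono]
  -- Symmetry of I lets the relation between C and L collapse the double sum to its diagonal.
  have h2 : (2 : ℝ) • ∑ s, I s s = 0 := by
    calc (2 : ℝ) • ∑ s, I s s = ∑ s, ∑ t, (C t (L s (I s t)) + C s (L t (I s t))) := by
          simp only [hCL, Finset.sum_ite_eq, Finset.mem_univ, if_true, Finset.smul_sum]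
      _ = ∑ s, ∑ t, C t (L s (I s t)) + ∑ s, ∑ t, C s (L t (I t s)) := by
          rw [← Finset.sum_add_distrib]
          refine Finset.sum_congr rfl fun s _ => ?_
          rw [← Finset.sum_add_distrib]
          exact Finset.sum_congr rfl fun t _ => by rw [hsymm t s]
      _ = 0 := by rw [hzero, Finset.sum_comm, hzero, zero_add]
  exact (smul_eq_zero.mp h2).resolve_left two_ne_zero

/-- The mean value property, for the radial weights of `exists_radial_cutoff`. -/
lemma integral_smul_dilation_eq
    (hCL : ∀ s t a, C t (L s a) + C s (L t a) = if s = t then (2 : ℝ) • a else 0)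
    {φ Ψ : (Fin n → ℝ) → ℝ} (hφ : ContDiff ℝ ∞ φ) (hΨ : ContDiff ℝ ∞ Ψ)
    (hφs : HasCompactSupport φ) (hΨs : HasCompactSupport Ψ)
    (hφΨ : ∀ s y, fderiv ℝ Ψ y (Pi.single s 1) = φ y * y s)
    {G : (Fin n → ℝ) → V} (hG : ContDiff ℝ 1 G)
    (hmono : ∀ x, ∑ s, L s (fderiv ℝ G x (Pi.single s 1)) = 0) (x : Fin n → ℝ) (r : ℝ) :
    ∫ y, φ y • G (x + r • y) = (∫ y, φ y) • G x := by
  have hG' := hG.continuous_fderiv one_ne_zero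
  have key : ∀ ρ : ℝ, ∫ y, φ y • fderiv ℝ G (x + ρ • y) y =
      ∑ s, ∫ y, fderiv ℝ Ψ y (Pi.single s 1) • fderiv ℝ G (x + ρ • y) (Pi.single s 1) := by
    intro ρ
    rw [← integral_finsetSum]
    · congr 1
      ext1 y
      conv_lhs => rw [pi_eq_sum_univ' y, map_sum, Finset.smul_sum]
      refine Finset.sum_congr rfl fun s _ => ?_
      rw [map_smul, smul_smul, hφΨ, ← pi_eq_sum_univ' y]
    · intro s _
      refine integrable_smul_of_hasCompactSupport ?_ (hΨs.fderiv_apply ℝ _) ?_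
      · exact (hΨ.continuous_fderiv (by simp)).clm_apply continuous_const
      · fun_prop
  -- The dilate of G solves the same system, so weak harmonicity applies to it, with an extra factor
  -- ρ. Hence ρ = 0 needs its own argument: there the integrand is a derivative of Ψ times a
  -- constant.
  have hne : ∀ ρ : ℝ, ρ ≠ 0 → ∫ y, φ y • fderiv ℝ G (x + ρ • y) y = 0 := by
    intro ρ hρ
    have hGρ : ContDiff ℝ 1 fun y : Fin n → ℝ => G (x + ρ • y) := hG.comp (by fun_prop)
    have := sum_integral_fderiv_smul_fderiv_eq_zero hCL hΨ hΨs hGρ fun z => by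
      simp only [fderiv_dilation hG, map_smul, ← Finset.smul_sum, hmono, smul_zero]
    simp only [fderiv_dilation hG, smul_comm _ ρ, integral_smul, ← Finset.smul_sum] at this
    rw [key]
    exact (smul_eq_zero.mp this).resolve_left hρ
  have hzero : ∫ y, φ y • fderiv ℝ G (x + (0 : ℝ) • y) y = 0 := by
    rw [key]
    refine Finset.sum_eq_zero fun s _ => ?_
    have := integral_smul_fderiv_of_hasCompactSupport (hΨ.of_le (by simp)) hΨs
      (contDiff_const (c := fderiv ℝ G x (Pi.single s 1))) (Pi.single s 1)
    simpa using this
  have hd : ∀ ρ : ℝ, HasDerivAt (fun r : ℝ => ∫ y, φ y • G (x + r • y)) 0 ρ := by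
    intro ρ
    have := hasDerivAt_integral_smul_dilation hφ.continuous hφs hG x ρ
    by_cases hρ : ρ = 0
    · subst hρ; rwa [hzero] at this
    · rwa [hne ρ hρ] at this
  have := is_const_of_deriv_eq_zero (fun ρ => (hd ρ).differentiableAt) (fun ρ => (hd ρ).deriv) r 0
  rw [this]
  simp [integral_smul_const]

/-- `C¹` solutions are smooth. -/
lemma contDiff_of_sum_fderiv_eq_zero
    (hCL : ∀ s t a, C t (L s a) + C s (L t a) = if s = t then (2 : ℝ) • a else 0)
    {G : (Fin n → ℝ) → V} (hG : ContDiff ℝ 1 G)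
    (hmono : ∀ x, ∑ s, L s (fderiv ℝ G x (Pi.single s 1)) = 0) : ContDiff ℝ ∞ G := by
  obtain ⟨φ, Ψ, hφ, hΨ, hφs, hΨs, hpos, hφΨ⟩ := exists_radial_cutoff n
  have h := hφs.contDiff_convolution_left (n := (⊤ : ℕ∞)) (μ := volume) (ContinuousLinearMap.lsmul ℝ ℝ) hφ
    (hG.continuous.locallyIntegrable (μ := volume))
  have : G = fun x => (∫ y, φ y)⁻¹ •
      (MeasureTheory.convolution φ G (ContinuousLinearMap.lsmul ℝ ℝ) volume) x := by
    ext1 x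
    -- Radius -1 turns the weighted mean into the convolution φ * G.
    have := integral_smul_dilation_eq hCL hφ hΨ hφs hΨs hφΨ hG hmono x (-1)
    simp only [neg_smul, one_smul, ← sub_eq_add_neg] at this
    rw [convolution_def]
    simp only [ContinuousLinearMap.lsmul_apply]
    rw [this, smul_smul, inv_mul_cancel₀ hpos.ne', one_smul]
  rw [this]
  exact contDiff_const.smul h

end MeanValue

end Hypercomplex

namespace Hypercomplex

open MeasureTheory Set Filter Topology
open scoped ContDiff

/-! ### Interior estimates and uniqueness for the Cauchy problem -/

section Uniqueness

variable {n : ℕ} {V : Type*} [NormedAddCommGroup V] [NormedSpace ℝ V] {C L : Fin n → V →L[ℝ] V}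

/-- The system has constant coefficients, so it commutes with directional derivatives. -/
lemma sum_fderiv_directional_eq_zero {G : (Fin n → ℝ) → V} (hG : ContDiff ℝ ∞ G)
    (hmono : ∀ x, ∑ s, L s (fderiv ℝ G x (Pi.single s 1)) = 0) (u x : Fin n → ℝ) :
    ∑ s, L s (fderiv ℝ (fun z => fderiv ℝ G z u) x (Pi.single s 1)) = 0 := by
  have hd : Differentiable ℝ (fderiv ℝ G) :=
    (hG.fderiv_right (m := ∞) (by simp)).differentiable (by simp)
  have h := hasFDerivAt_const (𝕜 := ℝ) (0 : V) x
  have h2 : HasFDerivAt (fun z => ∑ s, L s (fderiv ℝ G z (Pi.single s 1)))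
      (∑ s, (L s) ∘L (fderiv ℝ (fun z => fderiv ℝ G z (Pi.single s 1)) x)) x :=
    HasFDerivAt.fun_sum fun s _ => (L s).hasFDerivAt.comp x
      ((hd x).clm_apply (differentiableAt_const (Pi.single s (1 : ℝ) : Fin n → ℝ))).hasFDerivAt
  simp only [hmono] at h2
  have h3 := congrArg (fun T : (Fin n → ℝ) →L[ℝ] V => T u) (h2.unique h)
  simp only [sum_apply, ContinuousLinearMap.comp_apply, zero_apply] at h3
  rw [← h3]
  refine Finset.sum_congr rfl fun s _ => ?_
  rw [fderiv_clm_apply (hd x) (by fun_prop), fderiv_clm_apply (hd x) (by fun_prop)]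
  simpa using congrArg (L s) (((hG.of_le (m := 2) ENat.LEInfty.out).contDiffAt.isSymmSndFDerivAt (by simp))
    (Pi.single s 1) u)

variable [CompleteSpace V]

/-- The interior estimate for a directional derivative. -/
lemma exists_norm_fderiv_le
    (hCL : ∀ s t a, C t (L s a) + C s (L t a) = if s = t then (2 : ℝ) • a else 0)
    (u : Fin n → ℝ) :
    ∃ K : ℝ, 0 < K ∧ ∀ G : (Fin n → ℝ) → V, ContDiff ℝ ∞ G →
      (∀ x, ∑ s, L s (fderiv ℝ G x (Pi.single s 1)) = 0) → ∀ (x : Fin n → ℝ) (δ B : ℝ), 0 < δ →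
      (∀ z, ‖z - x‖ ≤ δ → ‖G z‖ ≤ B) → ‖fderiv ℝ G x u‖ ≤ K / δ * B := by
  obtain ⟨φ, Ψ, hφ, hΨ, hφs, hΨs, hpos, hφΨ⟩ := exists_radial_cutoff n
  obtain ⟨R, hR, hsub⟩ := hφs.isCompact.isBounded.subset_closedBall_lt 0 (0 : Fin n → ℝ)
  set c := ∫ y, φ y with hc
  set I := ∫ y, ‖fderiv ℝ φ y u‖ with hI
  have hI0 : 0 ≤ I := integral_nonneg fun _ => norm_nonneg _
  have hφ' : Continuous fun y => fderiv ℝ φ y u :=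
    (hφ.continuous_fderiv (by simp)).clm_apply continuous_const
  have hφi : Integrable fun y => ‖fderiv ℝ φ y u‖ :=
    (hφ'.integrable_of_hasCompactSupport (hφs.fderiv_apply ℝ u)).norm
  -- I may be 0; I + 1 keeps the constant positive.
  refine ⟨c⁻¹ * R * (I + 1), by positivity, fun G hG hmono x δ B hδ hB => ?_⟩
  have hB0 : 0 ≤ B := (norm_nonneg _).trans (hB x (by simpa using hδ.le))
  -- With this r, x + r y stays within δ of x for y in the support of φ.
  set r := δ / R with hr
  have hr0 : 0 < r := by positivity
  have hG1 : ContDiff ℝ 1 G := hG.of_le (by simp)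
  have hH : ContDiff ℝ ∞ fun z => fderiv ℝ G z u :=
    (hG.fderiv_right (m := ∞) (by simp)).clm_apply contDiff_const
  -- The mean value property is applied to the derivative, itself a solution; integrating by parts
  -- then trades the derivative of G for a factor 1/r.
  have h1 := integral_smul_dilation_eq hCL hφ hΨ hφs hΨs hφΨ (hH.of_le (by simp))
    (sum_fderiv_directional_eq_zero hG hmono u) x r
  have h2 := integral_smul_fderiv_of_hasCompactSupport (hφ.of_le (by simp)) hφs
    (G := fun y => G (x + r • y)) (hG1.comp (by fun_prop)) u
  simp only [fderiv_dilation hG1, smul_comm _ r, integral_smul] at h2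
  rw [h1, smul_smul] at h2
  have h3 : ‖∫ y, fderiv ℝ φ y u • G (x + r • y)‖ ≤ ∫ y, ‖fderiv ℝ φ y u‖ * B := by
    refine norm_integral_le_of_norm_le (hφi.mul_const B) (.of_forall fun y => ?_)
    rw [norm_smul]
    by_cases hy : y ∈ tsupport φ
    · refine mul_le_mul_of_nonneg_left (hB _ ?_) (norm_nonneg _)
      have := mem_closedBall_zero_iff.1 (hsub hy)
      rw [add_sub_cancel_left, norm_smul, Real.norm_of_nonneg hr0.le, hr, div_mul_eq_mul_div,
        div_le_iff₀ hR]
      gcongr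
    · have : fderiv ℝ φ y = 0 := by
        by_contra h
        exact hy (support_fderiv_subset ℝ (f := φ) h)
      simp [this]
  rw [integral_mul_const, ← norm_neg, ← h2, norm_smul, Real.norm_of_nonneg (by positivity)] at h3
  have h4 : ‖fderiv ℝ G x u‖ ≤ I * B / (r * c) := by
    rw [le_div_iff₀ (by positivity)]
    linarith
  refine h4.trans ?_
  rw [show c⁻¹ * R * (I + 1) / δ * B = (I + 1) * B / (r * c) by rw [hr]; field_simp]
  gcongr
  linarith

/-- The iterated derivatives in a fixed direction. -/
noncomputable def iterDirDeriv (u : Fin n → ℝ) (G : (Fin n → ℝ) → V) (k : ℕ) : (Fin n → ℝ) → V :=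
  (fun H z => fderiv ℝ H z u)^[k] G

/-- Uniqueness in the Cauchy problem with data on the hyperplane `x₀ = 0`. -/
lemma eq_zero_of_sum_fderiv_eq_zero {m : ℕ} {C L : Fin (m + 1) → V →L[ℝ] V}
    (hCL : ∀ s t a, C t (L s a) + C s (L t a) = if s = t then (2 : ℝ) • a else 0)
    (hL0 : ∀ a, L 0 a = a)
    {G : (Fin (m + 1) → ℝ) → V} (hG : ContDiff ℝ 1 G)
    (hmono : ∀ x, ∑ s, L s (fderiv ℝ G x (Pi.single s 1)) = 0)
    (h0 : ∀ x, x 0 = 0 → G x = 0) : G = 0 := by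
  let S : Set ((Fin (m + 1) → ℝ) → V) := {G | ContDiff ℝ ∞ G ∧
    (∀ x, ∑ s, L s (fderiv ℝ G x (Pi.single s 1)) = 0) ∧ ∀ x, x 0 = 0 → G x = 0}
  have htan : ∀ G ∈ S, ∀ x, x 0 = 0 → ∀ s : Fin m, fderiv ℝ G x (Pi.single s.succ 1) = 0 := by
    rintro G ⟨hG, -, hz⟩ x hx s
    have hl : HasLineDerivAt ℝ G (fderiv ℝ G x (Pi.single s.succ 1)) x (Pi.single s.succ 1) :=
      (hG.differentiable (by simp) x).hasFDerivAt.hasLineDerivAt _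
    have : (fun t : ℝ => G (x + t • Pi.single s.succ 1)) = fun _ => 0 := by
      ext1 t
      exact hz _ (by simp [hx])
    rw [HasLineDerivAt, this] at hl
    exact hl.unique (hasDerivAt_const _ _)
  -- Tangential derivatives vanish on the hyperplane, so the equation with L 0 = id forces the
  -- normal one to vanish too. Iterating, all normal derivatives vanish there.
  have hS : ∀ a : ℝ, ∀ G ∈ S, (fun z => fderiv ℝ G z (Pi.single 0 a)) ∈ S := by
    intro a G hGS
    obtain ⟨hG, hmono, hz⟩ := hGS
    refine ⟨(hG.fderiv_right (m := ∞) (by simp)).clm_apply contDiff_const,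
      sum_fderiv_directional_eq_zero hG hmono _, fun x hx => ?_⟩
    have h := hmono x
    rw [Fin.sum_univ_succ, hL0] at h
    simp only [htan G ⟨hG, hmono, hz⟩ x hx, map_zero, Finset.sum_const_zero, add_zero] at h
    have : (Pi.single 0 a : Fin (m + 1) → ℝ) = a • Pi.single 0 1 := by
      rw [← Pi.single_smul, smul_eq_mul, mul_one]
    simp only [this, map_smul, h, smul_zero]
  have hGS : G ∈ S := ⟨contDiff_of_sum_fderiv_eq_zero hCL hG hmono, hmono, h0⟩
  ext x
  set u : Fin (m + 1) → ℝ := Pi.single 0 (x 0) with hu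
  obtain ⟨K, hK, hest⟩ := exists_norm_fderiv_le hCL u
  -- Each derivative costs one ball of radius δ, hence the total radius kδ.
  have hbound : ∀ k : ℕ, ∀ G ∈ S, ∀ (x : Fin (m + 1) → ℝ) (δ B : ℝ), 0 < δ →
      (∀ z, ‖z - x‖ ≤ k * δ → ‖G z‖ ≤ B) → ‖iterDirDeriv u G k x‖ ≤ (K / δ) ^ k * B := by
    intro k
    induction k with
    | zero =>
      intro G _ x δ B _ h
      simpa [iterDirDeriv] using h x (by simp)
    | succ k ih =>
      intro G hG x δ B hδ h
      have := ih _ (hS _ G hG : (fun z => fderiv ℝ G z u) ∈ S) x δ (K / δ * B) hδ fun z hz =>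
        hest G hG.1 hG.2.1 z δ B hδ fun z' hz' => h z' <| by
          have := norm_add_le (z' - z) (z - x)
          rw [sub_add_sub_cancel] at this
          push_cast
          linarith
      rw [pow_succ, mul_assoc]
      exact this
  -- All lower Taylor coefficients at y vanish, so only the remainder is left.
  have htaylor : ∀ k : ℕ, ∀ G ∈ S, ∀ B : ℝ, ∀ y : Fin (m + 1) → ℝ, y 0 = 0 →
      (∀ t ∈ Icc (0 : ℝ) 1, ‖iterDirDeriv u G k (y + t • u)‖ ≤ B) →
      ∀ t ∈ Icc (0 : ℝ) 1, ‖G (y + t • u)‖ ≤ B * t ^ k / k.factorial := by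
    intro k
    induction k with
    | zero =>
      intro G _ B y _ h t ht
      simpa [iterDirDeriv] using h t ht
    | succ k ih =>
      intro G hG B y hy h
      have h1 := ih _ (hS _ G hG : (fun z => fderiv ℝ G z u) ∈ S) B y hy h
      have hd : ∀ t : ℝ, HasDerivAt (fun t : ℝ => G (y + t • u)) (fderiv ℝ G (y + t • u) u) t := by
        intro t
        have h1 : HasDerivAt (fun ρ : ℝ => y + ρ • u) u t := by
          simpa using ((hasDerivAt_id t).smul_const u).const_add y
        exact (hG.1.differentiable (by simp) _).hasFDerivAt.comp_hasDerivAt t h1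
      refine image_norm_le_of_norm_deriv_right_le_deriv_boundary
        (B' := fun t => B * t ^ k / k.factorial)
        (fun t _ => (hd t).continuousAt.continuousWithinAt)
        (fun t _ => (hd t).hasDerivWithinAt) ?_ (fun t => ?_)
        (fun t ht => h1 t (Ico_subset_Icc_self ht))
      · simp [hG.2.2 y hy]
      · have := ((hasDerivAt_pow (k + 1) t).const_mul B).div_const ((k + 1).factorial : ℝ)
        refine this.congr_deriv ?_
        have : (k.factorial : ℝ) ≠ 0 := by positivity
        rw [Nat.factorial_succ]
        push_cast [Nat.add_sub_cancel]
        field_simp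
  set y : Fin (m + 1) → ℝ := x - u with hy
  have hy0 : y 0 = 0 := by simp [hy, hu]
  -- Chosen so that K e / r = 1/2; the solution is global, so any radius is available.
  set r : ℝ := 2 * (K * Real.exp 1) with hr
  have hr0 : 0 < r := by positivity
  -- This ball contains every r-ball centred on the segment from y to x, so B does not depend on k.
  obtain ⟨B, hB⟩ := (isCompact_closedBall y (‖u‖ + r)).exists_bound_of_continuousOn
    hGS.1.continuous.continuousOn
  have hB0 : 0 ≤ B := (norm_nonneg _).trans (hB y (Metric.mem_closedBall_self (by positivity)))
  have hfin : ∀ k : ℕ, 0 < k → ‖G x‖ ≤ (1 / 2) ^ k * B := by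
    intro k hk
    have hk' : (0 : ℝ) < k := by exact_mod_cast hk
    have h1 := htaylor k G hGS ((K / (r / k)) ^ k * B) y hy0
      (fun t ht => hbound k G hGS _ _ _ (by positivity) fun z hz => hB z ?_) 1 (by simp)
    · rw [one_smul, hy, sub_add_cancel, one_pow, mul_one] at h1
      refine h1.trans ?_
      have hexp := Real.pow_div_factorial_le_exp (k : ℝ) hk'.le k
      calc (K / (r / k)) ^ k * B / k.factorial
          = (K / r) ^ k * B * ((k : ℝ) ^ k / k.factorial) := by
            rw [show K / (r / k) = K / r * k by field_simp, mul_pow]; ring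
        _ ≤ (K / r) ^ k * B * Real.exp k := by gcongr
        _ = (K / r * Real.exp 1) ^ k * B := by
            rw [mul_pow, ← Real.exp_nat_mul, mul_one]; ring
        _ = (1 / 2) ^ k * B := by
            rw [hr]; congr 2; field_simp
    · rw [mem_closedBall_iff_norm]
      rw [mul_div_cancel₀ _ hk'.ne'] at hz
      have h2 := norm_add_le (z - (y + t • u)) (t • u)
      rw [show z - (y + t • u) + t • u = z - y by abel, norm_smul, Real.norm_of_nonneg ht.1] at h2
      nlinarith [norm_nonneg u, ht.2]
  have hlim : Tendsto (fun k : ℕ => (1 / 2 : ℝ) ^ k * B) atTop (𝓝 0) := by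
    simpa using (tendsto_pow_atTop_nhds_zero_of_lt_one (r := (1 / 2 : ℝ)) (by norm_num)
      (by norm_num)).mul_const B
  have := ge_of_tendsto hlim (eventually_atTop.2 ⟨1, fun k hk => hfin k hk⟩)
  exact norm_le_zero_iff.1 this

end Uniqueness

end Hypercomplex

namespace Hypercomplex

open Set Filter Topology
open scoped ContDiff

/-! ### Transfer to real coordinates, and the square of the Dirac operator -/

section Coordinates

variable {A : Type*} [NonAssocRing A] [Module ℝ A] {d n : ℕ}

/-- The vector of components of `f`. -/
noncomputable def coords (b : Module.Basis (Fin (d + 1)) ℝ A) (f : (Fin n → ℝ) → A) :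
    (Fin n → ℝ) → Fin (d + 1) → ℝ :=
  fun x => b.equivFun (f x)

/-- A linear endomorphism of `A`, acting on components. -/
noncomputable def coordOp (b : Module.Basis (Fin (d + 1)) ℝ A) (T : A →ₗ[ℝ] A) :
    (Fin (d + 1) → ℝ) →L[ℝ] (Fin (d + 1) → ℝ) :=
  LinearMap.toContinuousLinearMap (b.equivFun.conj T)

/-- The operator `f ↦ ∑ₛ T_s (∂f/∂x_s)`, for a family `T` of linear endomorphisms of `A`. -/
noncomputable def dirac (b : Module.Basis (Fin (d + 1)) ℝ A) (T : Fin n → A →ₗ[ℝ] A)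
    (f : (Fin n → ℝ) → A) : (Fin n → ℝ) → A :=
  fun x => ∑ s, T s (partialDeriv b s f x)

variable (b : Module.Basis (Fin (d + 1)) ℝ A)

lemma coordOp_apply (T : A →ₗ[ℝ] A) (a : A) : coordOp b T (b.equivFun a) = b.equivFun (T a) := by
  simp [coordOp, LinearEquiv.conj_apply]

lemma coordOp_apply' (T : A →ₗ[ℝ] A) (a : Fin (d + 1) → ℝ) :
    coordOp b T a = b.equivFun (T (b.equivFun.symm a)) := by
  simp [coordOp, LinearEquiv.conj_apply]

lemma isC1_iff (f : (Fin n → ℝ) → A) : IsC1 b f ↔ ContDiff ℝ 1 (coords b f) :=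
  contDiff_pi.symm

lemma coords_partialDeriv {f : (Fin n → ℝ) → A} {x : Fin n → ℝ}
    (hf : DifferentiableAt ℝ (coords b f) x) (s : Fin n) :
    coords b (partialDeriv b s f) x = fderiv ℝ (coords b f) x (Pi.single s 1) := by
  have h : partialDeriv b s f x =
      b.equivFun.symm fun t => lineDeriv ℝ (component b f t) x (Pi.single s 1) := by
    rw [Module.Basis.equivFun_symm_apply, partialDeriv]
  rw [coords, h, LinearEquiv.apply_symm_apply]
  ext t
  have := ((hasFDerivAt_pi'.1 hf.hasFDerivAt) t).hasLineDerivAt (Pi.single s 1)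
  exact this.lineDeriv

lemma coords_dirac (T : Fin n → A →ₗ[ℝ] A) {f : (Fin n → ℝ) → A} {x : Fin n → ℝ}
    (hf : DifferentiableAt ℝ (coords b f) x) :
    coords b (dirac b T f) x =
      ∑ s, coordOp b (T s) (fderiv ℝ (coords b f) x (Pi.single s 1)) := by
  simp only [← coords_partialDeriv b hf, coords, coordOp_apply, dirac, map_sum]

lemma coords_partialDeriv' {f : (Fin n → ℝ) → A} (hf : Differentiable ℝ (coords b f)) (s : Fin n) :
    coords b (partialDeriv b s f) = fun x => fderiv ℝ (coords b f) x (Pi.single s 1) :=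
  funext fun x => coords_partialDeriv b (hf x) s

lemma coords_dirac' (T : Fin n → A →ₗ[ℝ] A) {f : (Fin n → ℝ) → A}
    (hf : Differentiable ℝ (coords b f)) :
    coords b (dirac b T f) =
      fun x => ∑ s, coordOp b (T s) (fderiv ℝ (coords b f) x (Pi.single s 1)) :=
  funext fun x => coords_dirac b T (hf x)

lemma contDiff_coords_partialDeriv {f : (Fin n → ℝ) → A} (hf : ContDiff ℝ ∞ (coords b f))
    (s : Fin n) : ContDiff ℝ ∞ (coords b (partialDeriv b s f)) := by
  rw [coords_partialDeriv' b (hf.differentiable (by simp)) s]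
  exact (hf.fderiv_right (m := ∞) (by simp)).clm_apply contDiff_const

lemma contDiff_coords_dirac (T : Fin n → A →ₗ[ℝ] A) {f : (Fin n → ℝ) → A}
    (hf : ContDiff ℝ ∞ (coords b f)) : ContDiff ℝ ∞ (coords b (dirac b T f)) := by
  rw [coords_dirac' b T (hf.differentiable (by simp))]
  exact ContDiff.sum fun s _ => (coordOp b (T s)).contDiff.comp
    ((hf.fderiv_right (m := ∞) (by simp)).clm_apply contDiff_const)

lemma contDiff_coords_iterate_dirac (T : Fin n → A →ₗ[ℝ] A) {f : (Fin n → ℝ) → A}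
    (hf : ContDiff ℝ ∞ (coords b f)) (k : ℕ) : ContDiff ℝ ∞ (coords b ((dirac b T)^[k] f)) := by
  induction k with
  | zero => exact hf
  | succ k ih =>
    rw [Function.iterate_succ_apply']
    exact contDiff_coords_dirac b T ih

lemma coords_injective : Function.Injective (coords (n := n) b) := fun _ _ h =>
  funext fun x => b.equivFun.injective (congrFun h x)

/-- The square of a Dirac operator is minus the Laplacian. -/
lemma dirac_dirac (T : Fin n → A →ₗ[ℝ] A)
    (hT : ∀ s t a, T s (T t a) + T t (T s a) = if s = t then (-2 : ℝ) • a else 0)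
    {f : (Fin n → ℝ) → A} (hf : ContDiff ℝ ∞ (coords b f)) :
    dirac b T (dirac b T f) = fun x => -∑ s, partialDeriv b s (partialDeriv b s f) x := by
  refine coords_injective b (funext fun x => ?_)
  set g := coords b f with hg
  set L := fun s => coordOp b (T s) with hL
  set H : Fin n → Fin n → Fin (d + 1) → ℝ := fun s t =>
    fderiv ℝ (fun z => fderiv ℝ g z (Pi.single t 1)) x (Pi.single s 1) with hH
  have hd : Differentiable ℝ (fderiv ℝ g) :=
    (hf.fderiv_right (m := ∞) (by simp)).differentiable (by simp)
  have hsymm : ∀ s t, H s t = H t s := by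
    intro s t
    simp only [hH]
    rw [fderiv_clm_apply (hd x) (by fun_prop), fderiv_clm_apply (hd x) (by fun_prop)]
    simpa using ((hf.of_le (m := 2) ENat.LEInfty.out).contDiffAt.isSymmSndFDerivAt (by simp))
      (Pi.single s 1) (Pi.single t 1)
  have hLL : ∀ s t a, L s (L t a) + L t (L s a) = if s = t then (-2 : ℝ) • a else 0 := by
    intro s t a
    simp only [hL, coordOp_apply', LinearEquiv.symm_apply_apply, ← map_add, hT]
    split_ifs
    · rw [map_smul, LinearEquiv.apply_symm_apply]
    · rw [map_zero]
  have h1 : coords b (dirac b T (dirac b T f)) x = ∑ s, ∑ t, L s (L t (H s t)) := by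
    rw [coords_dirac b T ((contDiff_coords_dirac b T hf).differentiable (by simp) x)]
    refine Finset.sum_congr rfl fun s _ => ?_
    rw [coords_dirac' b T (hf.differentiable (by simp)), ← map_sum]
    congr 1
    have : HasFDerivAt (fun z => ∑ t, coordOp b (T t) (fderiv ℝ g z (Pi.single t 1)))
        (∑ t, (coordOp b (T t)) ∘L (fderiv ℝ (fun z => fderiv ℝ g z (Pi.single t 1)) x)) x :=
      HasFDerivAt.fun_sum fun t _ => (coordOp b (T t)).hasFDerivAt.comp x
        ((hd x).clm_apply (differentiableAt_const (Pi.single t (1 : ℝ) : Fin n → ℝ))).hasFDerivAt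
    rw [this.fderiv]
    simp [hL, hH]
  have h2 : coords b (fun x => -∑ s, partialDeriv b s (partialDeriv b s f) x) x
      = -∑ s, H s s := by
    have h3 : ∀ s, b.equivFun (partialDeriv b s (partialDeriv b s f) x) = H s s := by
      intro s
      have := coords_partialDeriv b
        ((contDiff_coords_partialDeriv b hf s).differentiable (by simp) x) s
      rw [coords_partialDeriv' b (hf.differentiable (by simp)) s] at this
      exact this
    rw [coords, map_neg, map_sum]
    simp only [h3]
  rw [h1, h2]
  have h4 : (2 : ℝ) • ∑ s, ∑ t, L s (L t (H s t)) = (2 : ℝ) • -∑ s, H s s := by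
    calc (2 : ℝ) • ∑ s, ∑ t, L s (L t (H s t))
        = ∑ s, ∑ t, L s (L t (H s t)) + ∑ s, ∑ t, L t (L s (H t s)) := by
          rw [two_smul]
          congr 1
          exact Finset.sum_comm
      _ = ∑ s, ∑ t, (L s (L t (H s t)) + L t (L s (H s t))) := by
          simp only [← Finset.sum_add_distrib, hsymm]
      _ = (2 : ℝ) • -∑ s, H s s := by
          simp only [hLL, Finset.sum_ite_eq, Finset.mem_univ, if_true, neg_smul, smul_neg,
            Finset.sum_neg_distrib, Finset.smul_sum]
  exact smul_right_injective _ two_ne_zero h4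

end Coordinates

/-! ### Degree drop and termination of the series -/

section Polynomials

variable {A : Type*} [NonAssocRing A] [Module ℝ A] {d n : ℕ}
  (b : Module.Basis (Fin (d + 1)) ℝ A)

lemma hasFDerivAt_eval (p : MvPolynomial (Fin n) ℝ) (x : Fin n → ℝ) :
    HasFDerivAt (fun x => MvPolynomial.eval x p)
      (∑ i, MvPolynomial.eval x (MvPolynomial.pderiv i p) •
        ContinuousLinearMap.proj (R := ℝ) (φ := fun _ : Fin n => ℝ) i) x := by
  classical
  induction p using MvPolynomial.induction_on with
  | C a => simpa using hasFDerivAt_const (𝕜 := ℝ) a x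
  | add p q hp hq =>
    simp only [map_add, add_smul, Finset.sum_add_distrib]
    exact hp.add hq
  | mul_X p i hp =>
    have := hp.mul (hasFDerivAt_apply (𝕜 := ℝ) i x)
    simp only [map_mul, MvPolynomial.eval_X]
    refine this.congr_fderiv ?_
    ext y
    simp [Derivation.leibniz, MvPolynomial.pderiv_X, Pi.single_apply, add_mul,
      Finset.sum_add_distrib, Finset.mul_sum, apply_ite, mul_assoc]

lemma contDiff_eval (p : MvPolynomial (Fin n) ℝ) :
    ContDiff ℝ ∞ (fun x => MvPolynomial.eval x p) := by
  induction p using MvPolynomial.induction_on with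
  | C a => simpa using contDiff_const
  | add p q hp hq => simpa using hp.add hq
  | mul_X p i hp => simpa using hp.mul (contDiff_apply ℝ ℝ i)

lemma contDiff_coords_of_isPolynomialMap {f : (Fin n → ℝ) → A} (hf : IsPolynomialMap b f) :
    ContDiff ℝ ∞ (coords b f) := by
  refine contDiff_pi.2 fun t => ?_
  obtain ⟨p, hp⟩ := hf t
  rw [show (fun x => coords b f x t) = fun x => MvPolynomial.eval x p from funext hp]
  exact contDiff_eval p

/-- The polynomials of total degree less than `N`. -/
noncomputable def polyLT (n N : ℕ) : Submodule ℝ (MvPolynomial (Fin n) ℝ) :=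
  MvPolynomial.restrictSupport ℝ {μ | μ.degree < N}

lemma pderiv_mem_polyLT {N : ℕ} {p : MvPolynomial (Fin n) ℝ} (hp : p ∈ polyLT n (N + 1))
    (i : Fin n) : MvPolynomial.pderiv i p ∈ polyLT n N := by
  classical
  rw [polyLT, MvPolynomial.mem_restrictSupport_iff] at hp ⊢
  intro μ hμ
  have h1 : μ + Finsupp.single i 1 ∈ p.support := by
    rw [Finset.mem_coe, MvPolynomial.mem_support_iff, MvPolynomial.coeff_pderiv] at hμ
    rw [MvPolynomial.mem_support_iff]
    intro h
    simp [h] at hμ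
  have h2 := hp h1
  simp only [mem_ofPred_eq, map_add, Finsupp.degree_single] at h2 ⊢
  omega

/-- `f` is a polynomial map of degree less than `N`. -/
def IsPolyLT (N : ℕ) (f : (Fin n → ℝ) → A) : Prop :=
  ∀ t, ∃ p ∈ polyLT n N, ∀ x, component b f t x = MvPolynomial.eval x p

lemma IsPolynomialMap.exists_isPolyLT {f : (Fin n → ℝ) → A} (hf : IsPolynomialMap b f) :
    ∃ N, IsPolyLT b N f := by
  choose p hp using hf
  refine ⟨(Finset.univ.sup fun t => (p t).totalDegree) + 1, fun t => ⟨p t, ?_, hp t⟩⟩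
  rw [polyLT, MvPolynomial.mem_restrictSupport_iff]
  intro μ hμ
  have h1 := MvPolynomial.le_totalDegree hμ
  have h2 := Finset.le_sup (f := fun t => (p t).totalDegree) (Finset.mem_univ t)
  exact Nat.lt_succ_of_le (h1.trans h2)

lemma IsPolyLT.dirac {N : ℕ} {f : (Fin n → ℝ) → A} (hf : IsPolyLT b (N + 1) f)
    (T : Fin n → A →ₗ[ℝ] A) : IsPolyLT b N (dirac b T f) := by
  intro t
  choose p hp hfp using hf
  refine ⟨∑ s, ∑ u, b.repr (T s (b u)) t • MvPolynomial.pderiv s (p u),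
    Submodule.sum_mem _ fun s _ => Submodule.sum_mem _ fun u _ =>
      Submodule.smul_mem _ _ (pderiv_mem_polyLT (hp u) s), fun x => ?_⟩
  have h : ∀ s u, lineDeriv ℝ (component b f u) x (Pi.single s 1) =
      MvPolynomial.eval x (MvPolynomial.pderiv s (p u)) := by
    intro s u
    rw [show component b f u = fun x => MvPolynomial.eval x (p u) from funext (hfp u),
      ((hasFDerivAt_eval (p u) x).hasLineDerivAt _).lineDeriv]
    simp [Pi.single_apply]
  simp [component, Hypercomplex.dirac, partialDeriv, h, mul_comm]

/-- The degree bound is strict, so the bound 0 leaves no monomials. -/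
lemma IsPolyLT.eq_zero {f : (Fin n → ℝ) → A} (hf : IsPolyLT b 0 f) : f = 0 := by
  refine coords_injective b (funext fun x => funext fun t => ?_)
  obtain ⟨p, hp, hfp⟩ := hf t
  have : p = 0 := by
    rw [polyLT, MvPolynomial.mem_restrictSupport_iff] at hp
    rw [← MvPolynomial.support_eq_empty, Finset.eq_empty_iff_forall_notMem]
    intro μ hμ
    simpa using hp hμ
  have h := hfp x
  rw [this, map_zero] at h
  simpa [coords, component] using h

lemma IsPolyLT.iterate_dirac_eq_zero (T : Fin n → A →ₗ[ℝ] A) {N : ℕ} :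
    ∀ {f : (Fin n → ℝ) → A}, IsPolyLT b N f → ∀ k ≥ N, (Hypercomplex.dirac b T)^[k] f = 0 := by
  have hz : ∀ k, (Hypercomplex.dirac b T)^[k] 0 = 0 := by
    have h0 : Hypercomplex.dirac b T 0 = 0 := by
      refine IsPolyLT.eq_zero b (IsPolyLT.dirac b (fun t => ⟨0, zero_mem _, fun x => ?_⟩) T)
      simp [component]
    exact fun k => Function.iterate_fixed h0 k
  induction N with
  | zero =>
    intro f hf k _
    rw [hf.eq_zero, hz]
  | succ N ih =>
    intro f hf k hk
    obtain ⟨k, rfl⟩ : ∃ j, k = j + 1 := ⟨k - 1, by omega⟩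
    rw [Function.iterate_succ_apply]
    exact ih (hf.dirac b T) k (by omega)

end Polynomials

end Hypercomplex

namespace Hypercomplex

open Set Filter Topology
open scoped ContDiff

/-! ### The Cauchy-Kovalevskaya extension: existence and uniqueness -/

section Extension

lemma hasDerivAt_neg_pow_div_factorial (k : ℕ) (t : ℝ) :
    HasDerivAt (fun t : ℝ => (-t) ^ (k + 1) / ((k + 1).factorial : ℝ))
      (-((-t) ^ k / (k.factorial : ℝ))) t := by
  refine (((hasDerivAt_neg t).fun_pow (k + 1)).div_const ((k + 1).factorial : ℝ)).congr_deriv ?_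
  have : (k.factorial : ℝ) ≠ 0 := by positivity
  rw [Nat.factorial_succ]
  push_cast [Nat.add_sub_cancel]
  field_simp

/-- The finite Cauchy-Kovalevskaya series of a terminating sequence. -/
lemma contDiff_and_sum_fderiv_series {m : ℕ} {V : Type*} [NormedAddCommGroup V] [NormedSpace ℝ V]
    {L : Fin (m + 1) → V →L[ℝ] V} (hL0 : ∀ a, L 0 a = a) {g : ℕ → (Fin m → ℝ) → V}
    (hg : ∀ k, ContDiff ℝ ∞ (g k))
    (hrec : ∀ k y, g (k + 1) y = ∑ s : Fin m, L s.succ (fderiv ℝ (g k) y (Pi.single s 1)))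
    {N : ℕ} (hN : g (N + 1) = 0) :
    ContDiff ℝ 1 (fun x : Fin (m + 1) → ℝ => ∑ k ∈ Finset.range (N + 1),
        ((-(x 0)) ^ k / (k.factorial : ℝ)) • g k fun s => x s.succ) ∧
      ∀ x, ∑ s, L s (fderiv ℝ (fun x : Fin (m + 1) → ℝ => ∑ k ∈ Finset.range (N + 1),
        ((-(x 0)) ^ k / (k.factorial : ℝ)) • g k fun s => x s.succ) x (Pi.single s 1)) = 0 := by
  set U : (Fin (m + 1) → ℝ) → V := fun x => ∑ k ∈ Finset.range (N + 1),
    ((-(x 0)) ^ k / (k.factorial : ℝ)) • g k fun s => x s.succ with hU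
  have hC : ContDiff ℝ ∞ U := by
    refine ContDiff.sum fun k _ => ContDiff.smul ?_ ((hg k).comp ?_) <;> fun_prop
  refine ⟨hC.of_le (by simp), fun x => ?_⟩
  have hUd := hC.differentiable (by simp) x
  have h0 : fderiv ℝ U x (Pi.single 0 1) = -∑ k ∈ Finset.range N,
      ((-(x 0)) ^ k / (k.factorial : ℝ)) • g (k + 1) fun s => x s.succ := by
    have h1 : HasLineDerivAt ℝ U (-∑ k ∈ Finset.range N,
        ((-(x 0)) ^ k / (k.factorial : ℝ)) • g (k + 1) fun s => x s.succ) x (Pi.single 0 1) := by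
      -- The k = 0 term is constant in x_0; it is split off so that differentiation shifts the
      -- index.
      have hx : (fun t : ℝ => U (x + t • Pi.single 0 1)) = fun t => ∑ k ∈ Finset.range N,
          ((-(x 0 + t)) ^ (k + 1) / ((k + 1).factorial : ℝ)) • (g (k + 1) fun s => x s.succ) +
          g 0 fun s => x s.succ := by
        ext1 t
        rw [hU]
        simp only []
        rw [Finset.sum_range_succ']
        simp
      rw [HasLineDerivAt, hx, ← Finset.sum_neg_distrib]
      refine HasDerivAt.add_const _ (HasDerivAt.fun_sum fun k _ => ?_)
      rw [← neg_smul]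
      refine HasDerivAt.smul_const ?_ _
      have := hasDerivAt_neg_pow_div_factorial k (x 0 + 0)
      simpa using this.comp_const_add (x 0) 0
    exact (hUd.hasFDerivAt.hasLineDerivAt _).unique h1
  have hs : ∀ s : Fin m, fderiv ℝ U x (Pi.single s.succ 1) = ∑ k ∈ Finset.range (N + 1),
      ((-(x 0)) ^ k / (k.factorial : ℝ)) •
        fderiv ℝ (g k) (fun s => x s.succ) (Pi.single s 1) := by
    intro s
    have h1 : HasLineDerivAt ℝ U (∑ k ∈ Finset.range (N + 1), ((-(x 0)) ^ k / (k.factorial : ℝ)) •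
        fderiv ℝ (g k) (fun s => x s.succ) (Pi.single s 1)) x (Pi.single s.succ 1) := by
      have hx : (fun t : ℝ => U (x + t • Pi.single s.succ 1)) =
          fun t => ∑ k ∈ Finset.range (N + 1), ((-(x 0)) ^ k / (k.factorial : ℝ)) •
            g k ((fun s => x s.succ) + t • Pi.single s 1) := by
        ext1 t
        rw [hU]
        refine Finset.sum_congr rfl fun k _ => ?_
        congr 2
        · simp
        · ext i
          simp [Pi.single_apply]
      rw [HasLineDerivAt, hx]
      refine HasDerivAt.fun_sum fun k _ => HasDerivAt.const_smul _ ?_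
      exact ((hg k).differentiable (by simp) _).hasFDerivAt.hasLineDerivAt (Pi.single s 1)
    exact (hUd.hasFDerivAt.hasLineDerivAt _).unique h1
  rw [Fin.sum_univ_succ, hL0, h0]
  simp only [hs, map_sum, map_smul]
  rw [Finset.sum_comm]
  simp only [← Finset.smul_sum, ← hrec]
  -- The two sums cancel except for the top tangential term, which contains g (N + 1) = 0.
  rw [Finset.sum_range_succ, hN]
  simp

variable {A : Type*} [NonAssocRing A] [Module ℝ A] {M : Submodule ℝ A} {d m : ℕ}
  (b : Module.Basis (Fin (d + 1)) ℝ A) (v : Module.Basis (Fin (m + 1)) ℝ M)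
  (T : Fin (m + 1) → A →ₗ[ℝ] A) (f₀ : (Fin m → ℝ) → A)

/-- The Cauchy-Kovalevskaya extension for the operator `∑ₛ T_s ∂_s`. -/
noncomputable def ckExtension : M → A :=
  fun x => ∑ᶠ k : ℕ, ((-(v.repr x 0)) ^ k / (k.factorial : ℝ)) •
    ((dirac b fun s : Fin m => T s.succ)^[k] f₀) (fun s : Fin m => v.repr x s.succ)

lemma repr_sum_smul (x : Fin (m + 1) → ℝ) (s : Fin (m + 1)) :
    v.repr (∑ s, x s • v s) s = x s := by
  rw [← v.equivFun_symm_apply, ← v.equivFun_apply, LinearEquiv.apply_symm_apply]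

lemma inCoords_eq_of_extends {F : M → A} (hF : Extends v F f₀) {x : Fin (m + 1) → ℝ}
    (hx : x 0 = 0) : inCoords v F x = f₀ fun s => x s.succ := by
  rw [← hF, inCoords, Fin.sum_univ_succ, hx, zero_smul, zero_add]

lemma inCoords_injective : Function.Injective (inCoords (A := A) v) := fun F G h => funext fun x => by
  have := congrFun h (v.repr x)
  simpa only [inCoords, v.sum_repr] using this

variable {b f₀} in
lemma inCoords_ckExtension {N : ℕ} (hN : ∀ k ≥ N, (dirac b fun s : Fin m => T s.succ)^[k] f₀ = 0)
    (x : Fin (m + 1) → ℝ) :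
    inCoords v (ckExtension b v T f₀) x = ∑ k ∈ Finset.range (N + 1),
      ((-(x 0)) ^ k / (k.factorial : ℝ)) •
        ((dirac b fun s : Fin m => T s.succ)^[k] f₀) fun s => x s.succ := by
  simp only [inCoords, ckExtension, repr_sum_smul]
  refine finsum_eq_sum_of_support_subset _ fun k hk => ?_
  by_contra h
  rw [Finset.mem_coe, Finset.mem_range, not_lt] at h
  refine hk ?_
  simp [hN k (by omega)]

/-- Existence and uniqueness of the Cauchy-Kovalevskaya extension. -/
lemma ckExtension_spec (hT0 : T 0 = LinearMap.id)
    (hT : ∀ (s t : Fin m) (a : A), T s.succ (T t.succ a) + T t.succ (T s.succ a) =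
      if s = t then (-2 : ℝ) • a else 0)
    (hf₀ : IsPolynomialMap b f₀) :
    (IsC1 b (inCoords v (ckExtension b v T f₀)) ∧
      ∀ x, dirac b T (inCoords v (ckExtension b v T f₀)) x = 0) ∧
    Extends v (ckExtension b v T f₀) f₀ ∧
    ∀ F : M → A, (IsC1 b (inCoords v F) ∧ ∀ x, dirac b T (inCoords v F) x = 0) →
      Extends v F f₀ → F = ckExtension b v T f₀ := by
  obtain ⟨N, hN⟩ := hf₀.exists_isPolyLT
  have hN := hN.iterate_dirac_eq_zero b fun s : Fin m => T s.succ
  have hsm := contDiff_coords_of_isPolynomialMap b hf₀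
  set D := dirac b fun s : Fin m => T s.succ with hD
  set L := fun s => coordOp b (T s) with hL
  have hL0 : ∀ a, L 0 a = a := fun a => by simp only [hL, coordOp_apply', hT0, LinearMap.id_apply,
    LinearEquiv.apply_symm_apply]
  have hLL : ∀ (s t : Fin m) (a : Fin (d + 1) → ℝ), L s.succ (L t.succ a) + L t.succ (L s.succ a) =
      if s = t then (-2 : ℝ) • a else 0 := by
    intro s t a
    simp only [hL, coordOp_apply', LinearEquiv.symm_apply_apply, ← map_add, hT]
    split_ifs
    · rw [map_smul, LinearEquiv.apply_symm_apply]
    · rw [map_zero]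
  -- The conjugate operator ∂_0 - ∑ T_s ∂_s, whose composition with the original one is the
  -- Laplacian.
  set C : Fin (m + 1) → (Fin (d + 1) → ℝ) →L[ℝ] (Fin (d + 1) → ℝ) :=
    Fin.cons (ContinuousLinearMap.id ℝ _) fun s => -L s.succ with hC
  have hCL : ∀ s t a, C t (L s a) + C s (L t a) = if s = t then (2 : ℝ) • a else 0 := by
    intro s t a
    induction s using Fin.cases with
    | zero =>
      induction t using Fin.cases with
      | zero => simp [hC, hL0, two_smul]
      | succ t => simp [hC, hL0, (Fin.succ_ne_zero t).symm]
    | succ s =>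
      induction t using Fin.cases with
      | zero => simp [hC, hL0]
      | succ t =>
        have h := congrArg Neg.neg (hLL s t a)
        simp only [hC, Fin.cons_succ, neg_apply, Fin.succ_inj]
        rw [← neg_add, add_comm (L t.succ (L s.succ a)), h]
        split_ifs <;> simp
  have hsmk := contDiff_coords_iterate_dirac b (fun s : Fin m => T s.succ) hsm
  have hser := contDiff_and_sum_fderiv_series (L := L) hL0
    (g := fun k => coords b (D^[k] f₀)) hsmk (fun k y => by
      simp only [Function.iterate_succ_apply']
      exact coords_dirac b _ ((hsmk k).differentiable (by simp) y)) (N := N) (by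
      ext x
      simp [coords, hN (N + 1) (by omega)])
  have hck : (fun x : Fin (m + 1) → ℝ => ∑ k ∈ Finset.range (N + 1),
        ((-(x 0)) ^ k / (k.factorial : ℝ)) • coords b (D^[k] f₀) fun s => x s.succ) =
      coords b (inCoords v (ckExtension b v T f₀)) := by
    ext1 x
    rw [coords, inCoords_ckExtension v T hN x, map_sum]
    simp only [map_smul]
    rfl
  rw [hck] at hser
  have hext : Extends v (ckExtension b v T f₀) f₀ := by
    intro y
    have := inCoords_ckExtension v T hN (Fin.cons 0 y)
    rw [Finset.sum_range_succ'] at this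
    simpa [inCoords, Fin.sum_univ_succ] using this
  have hdirac : ∀ {F : M → A}, ContDiff ℝ 1 (coords b (inCoords v F)) →
      ((∀ x, dirac b T (inCoords v F) x = 0) ↔
        ∀ x, ∑ s, L s (fderiv ℝ (coords b (inCoords v F)) x (Pi.single s 1)) = 0) := by
    intro F hF
    refine forall_congr' fun x => ?_
    rw [← coords_dirac b T (hF.differentiable one_ne_zero x), coords,
      LinearEquiv.map_eq_zero_iff]
  refine ⟨⟨(isC1_iff b _).2 hser.1, (hdirac hser.1).2 hser.2⟩, hext, fun F hF hFe => ?_⟩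
  have hF1 := (isC1_iff b _).1 hF.1
  have hF2 := (hdirac hF1).1 hF.2
  have hz := eq_zero_of_sum_fderiv_eq_zero hCL hL0 (hF1.sub hser.1) (fun x => by
    rw [fderiv_fun_sub (hF1.differentiable one_ne_zero x) (hser.1.differentiable one_ne_zero x)]
    simp only [sub_apply, map_sub, Finset.sum_sub_distrib, hF2, hser.2, sub_zero])
    (fun x hx => by
      simp only [coords, inCoords_eq_of_extends v f₀ hFe hx,
        inCoords_eq_of_extends v f₀ hext hx, sub_self])
  exact inCoords_injective v (coords_injective b (sub_eq_zero.1 hz))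

end Extension

/-! ### Real-valued initial data -/

section RealValued

variable {A : Type*} [NonAssocRing A] [Module ℝ A] {d n : ℕ}
  (b : Module.Basis (Fin (d + 1)) ℝ A)

lemma partialDeriv_mem_span_one (hb0 : b 0 = 1) {f : (Fin n → ℝ) → A}
    (hf : ∀ y, ∃ r : ℝ, f y = r • (1 : A)) (s : Fin n) (y : Fin n → ℝ) :
    ∃ r : ℝ, partialDeriv b s f y = r • (1 : A) := by
  refine ⟨lineDeriv ℝ (component b f 0) y (Pi.single s 1), ?_⟩
  rw [partialDeriv, Fin.sum_univ_succ, hb0, add_eq_left]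
  refine Finset.sum_eq_zero fun t _ => ?_
  have : component b f t.succ = fun _ => 0 := by
    ext1 z
    obtain ⟨r, hr⟩ := hf z
    rw [component, hr, ← hb0]
    simp [Fin.succ_ne_zero]
  simp [this, lineDeriv]

/-- On real-valued functions the iterates of two Dirac operators with `T_s 1 = T'_s 1` agree, and
take values in every subspace containing `1` and the `T_s 1`. -/
lemma iterate_dirac_eq_and_mem (hb0 : b 0 = 1) {T T' : Fin n → A →ₗ[ℝ] A}
    (hT : ∀ s t a, T s (T t a) + T t (T s a) = if s = t then (-2 : ℝ) • a else 0)
    (hT' : ∀ s t a, T' s (T' t a) + T' t (T' s a) = if s = t then (-2 : ℝ) • a else 0)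
    (hTT' : ∀ s, T s 1 = T' s 1) (M : Submodule ℝ A) (h1 : (1 : A) ∈ M) (hM : ∀ s, T s 1 ∈ M)
    (k : ℕ) : ∀ f : (Fin n → ℝ) → A, ContDiff ℝ ∞ (coords b f) →
      (∀ y, ∃ r : ℝ, f y = r • (1 : A)) →
      (dirac b T)^[k] f = (dirac b T')^[k] f ∧ ∀ y, (dirac b T)^[k] f y ∈ M := by
  -- Two steps at a time, because only the square of the operator preserves real-valued functions.
  induction k using Nat.twoStepInduction with
  | zero =>
    intro f _ hf
    refine ⟨rfl, fun y => ?_⟩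
    obtain ⟨r, hr⟩ := hf y
    rw [Function.iterate_zero_apply, hr]
    exact M.smul_mem r h1
  | one =>
    intro f _ hf
    have hp := partialDeriv_mem_span_one b hb0 hf
    simp only [Function.iterate_one]
    refine ⟨funext fun y => Finset.sum_congr rfl fun s _ => ?_,
      fun y => M.sum_mem fun s _ => ?_⟩
    all_goals
      obtain ⟨r, hr⟩ := hp s y
      simp only [hr, map_smul]
    · rw [hTT']
    · exact M.smul_mem r (hM s)
  | more k ih _ =>
    intro f hfs hf
    simp only [Function.iterate_succ_apply, dirac_dirac b T hT hfs, dirac_dirac b T' hT' hfs]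
    refine ih _ ?_ fun y => ?_
    · rw [← dirac_dirac b T hT hfs]
      exact contDiff_coords_dirac b T (contDiff_coords_dirac b T hfs)
    · choose r hr using fun s => partialDeriv_mem_span_one b hb0
        (partialDeriv_mem_span_one b hb0 hf s) s y
      exact ⟨-∑ s, r s, by simp only [hr, neg_smul, Finset.sum_smul]⟩

end RealValued

/-! ### Polarised alternative laws -/

section Alternative

variable {A : Type*} [NonAssocRing A]

lemma IsAlternative.mul_mul_add (hA : IsAlternative A) (x y a : A) :
    x * (y * a) + y * (x * a) = (x * y + y * x) * a := by
  have h1 := (hA (x + y) a).1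
  have h2 := (hA x a).1
  have h3 := (hA y a).1
  simp only [associator, add_mul, mul_add] at h1 h2 h3 ⊢
  rw [← sub_eq_zero]
  rw [sub_eq_zero] at h2 h3
  rw [h2, h3] at h1
  rw [← neg_eq_zero, ← h1]
  abel

lemma IsAlternative.mul_mul_add' (hA : IsAlternative A) (x y a : A) :
    (a * x) * y + (a * y) * x = a * (x * y + y * x) := by
  have h1 := (hA a (x + y)).2.1
  have h2 := (hA a x).2.1
  have h3 := (hA a y).2.1
  simp only [associator, add_mul, mul_add] at h1 h2 h3 ⊢
  rw [← sub_eq_zero]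
  rw [sub_eq_zero] at h2 h3
  rw [h2, h3] at h1
  rw [← h1]
  abel

lemma mul_self_of_mem_imaginaryUnits [StarRing A] {x : A} (hx : x ∈ imaginaryUnits A) :
    x * x = -1 := by
  obtain ⟨h1, h2⟩ := hx
  rw [← h2, eq_neg_of_add_eq_zero_right h1]
  simp

end Alternative

end Hypercomplex

/-! ### The main theorem -/

/-- The basis `b` of `A` completes the hypercomplex basis `v` of `M`.  The first conjunct says that
the series defining the two extensions are finite sums. -/
theorem mainTheorem9 {A : Type*} [NonAssocRing A] [StarRing A] [Module ℝ A]
    [IsScalarTower ℝ A A] [SMulCommClass ℝ A A] [StarModule ℝ A]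
    (hA : IsAlternative A) {m d : ℕ} (hmd : m + 1 ≤ d + 1)
    (M : Submodule ℝ A) (hM : IsHypercomplexSubspace M)
    (v : Module.Basis (Fin (m + 1)) ℝ M) (hv : IsHypercomplexBasis v)
    (b : Module.Basis (Fin (d + 1)) ℝ A) (hb : ∀ s : Fin (m + 1), b (Fin.castLE hmd s) = (v s : A))
    (f₀ : (Fin m → ℝ) → A) (hf₀ : IsPolynomialMap b f₀) :
    (∃ N : ℕ, ∀ k ≥ N, (leftDiracB b v)^[k] f₀ = 0 ∧ (rightDiracB b v)^[k] f₀ = 0) ∧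
    (IsLeftMonogenic b v (leftCK b v f₀) ∧ Extends v (leftCK b v f₀) f₀ ∧
      ∀ F : M → A, IsLeftMonogenic b v F → Extends v F f₀ → F = leftCK b v f₀) ∧
    (IsRightMonogenic b v (rightCK b v f₀) ∧ Extends v (rightCK b v f₀) f₀ ∧
      ∀ F : M → A, IsRightMonogenic b v F → Extends v F f₀ → F = rightCK b v f₀) ∧
    ((∀ y, ∃ r : ℝ, f₀ y = r • (1 : A)) →
      leftCK b v f₀ = rightCK b v f₀ ∧ ∀ x : M, leftCK b v f₀ x ∈ M ∧ rightCK b v f₀ x ∈ M) := by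
  obtain ⟨-, hv0, hvi, hva⟩ := hv
  have hb0 : b 0 = 1 := by rw [← hv0, ← hb 0]; rfl
  have hsum : ∀ s t : Fin m, (v s.succ : A) * v t.succ + v t.succ * v s.succ =
      if s = t then (-2 : ℝ) • (1 : A) else 0 := by
    intro s t
    split_ifs with h
    · subst h
      rw [mul_self_of_mem_imaginaryUnits (hvi s), neg_smul, two_smul, neg_add]
    · rw [hva s t h, neg_add_cancel]
  let TL : Fin (m + 1) → A →ₗ[ℝ] A := fun s => LinearMap.mulLeft ℝ (v s : A)
  let TR : Fin (m + 1) → A →ₗ[ℝ] A := fun s => LinearMap.mulRight ℝ (v s : A)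
  have hTL0 : TL 0 = LinearMap.id := by ext a; simp [TL, hv0]
  have hTR0 : TR 0 = LinearMap.id := by ext a; simp [TR, hv0]
  have hTL : ∀ (s t : Fin m) (a : A), TL s.succ (TL t.succ a) + TL t.succ (TL s.succ a) =
      if s = t then (-2 : ℝ) • a else 0 := by
    intro s t a
    simp only [TL, LinearMap.mulLeft_apply, hA.mul_mul_add, hsum]
    split_ifs <;> simp
  have hTR : ∀ (s t : Fin m) (a : A), TR s.succ (TR t.succ a) + TR t.succ (TR s.succ a) =
      if s = t then (-2 : ℝ) • a else 0 := by
    intro s t a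
    -- Right multiplications compose in reverse order, so the indices come out as t = s.
    simp only [TR, LinearMap.mulRight_apply, hA.mul_mul_add', hsum, eq_comm (a := s)]
    split_ifs <;> simp
  obtain ⟨N, hN⟩ := hf₀.exists_isPolyLT
  refine ⟨⟨N, fun k hk => ⟨hN.iterate_dirac_eq_zero b (fun s : Fin m => TL s.succ) k hk,
    hN.iterate_dirac_eq_zero b (fun s : Fin m => TR s.succ) k hk⟩⟩,
    ckExtension_spec b v TL f₀ hTL0 hTL hf₀, ckExtension_spec b v TR f₀ hTR0 hTR hf₀, fun hr => ?_⟩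
  have key := fun k => iterate_dirac_eq_and_mem b hb0 hTL hTR (fun s => by simp [TL, TR]) M
    (hv0 ▸ (v 0).2) (fun s => by simp [TL]) k f₀ (contDiff_coords_of_isPolynomialMap b hf₀) hr
  have heq : leftCK b v f₀ = rightCK b v f₀ := by
    ext1 x
    refine finsum_congr fun k => congrArg _ (congrFun (key k).1 _)
  have hmem : ∀ x : M, leftCK b v f₀ x ∈ M := fun x =>
    finsum_induction (· ∈ M) M.zero_mem (fun _ _ => M.add_mem) fun k => M.smul_mem _ ((key k).2 _)
  exact ⟨heq, fun x => ⟨hmem x, heq ▸ hmem x⟩⟩
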